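/- Let $p$ be a prime with $p\equiv 3 \pmod 4$, and let $D$ be a positive integer not divisible by $p^2$ (in particular, $D$ may be any positive integer coprime to $p$). Then the quadratic form $$Q(x_1,x_2,x_3,x_4)=p x_1^2+p x_2^2+x_3^2-D x_4^2$$ has a nontrivial integer zero, i.e. there are integers $x_1,x_2,x_3,x_4$, not all zero, with $Q(x_1,x_2,x_3,x_4)=0$, if and only if $D$ is a quadratic residue modulo $p$, i.e. there is an integer $y$ with $y^2\equiv D \pmod p$. (Here $0$ counts as a quadratic residue.) -/

import Mathlib

open scoped NumberTheorySymbols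

/-! If `D` is a non-residue, reduction mod `p` gives `p ∣ x₃, x₄`; dividing by `p`, and since `-1`
is a non-residue, `p ∣ x₁, x₂`. Infinite descent leaves only the trivial zero. Conversely,
Dirichlet's theorem gives a prime `t ≡ 1 [MOD 4]` with `t ≡ -p` modulo `8d`, where `d` is the
prime-to-`p` part of `D`. As `t = u² + v²`, the form `p x₁² + p x₂²` represents `p t y²`, and a zero
of a ternary form suffices. Reciprocity supplies the residue conditions of Legendre's theorem
(`exists_ternary_zero`). -/

theorem not_isSquare_prime_mul {p m : ℕ} (hp : p.Prime) (hm : ¬ p ∣ m) : ¬ IsSquare (p * m) := by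
  rintro ⟨r, hr⟩
  have hpr : p ∣ r := by
    have : p ∣ r * r := hr ▸ dvd_mul_right p m
    exact (hp.dvd_mul.1 this).elim id id
  obtain ⟨k, rfl⟩ := hpr
  refine hm ⟨k * k, Nat.eq_of_mul_eq_mul_left hp.pos ?_⟩
  rw [hr]; ring

/-! ### Legendre's theorem -/

/-- The pigeonhole principle on a box, for three simultaneous congruences. -/
theorem exists_small_sub_of_zmod {a b c : ℕ} (ha : 0 < a) (hb : 0 < b) (hc : 0 < c)
    (r : ZMod a) (s : ZMod b) (u : ZMod c) :
    ∃ x y z : ℤ, (x, y, z) ≠ (0, 0, 0) ∧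
      x ^ 2 ≤ b * c ∧ y ^ 2 ≤ a * c ∧ z ^ 2 ≤ a * b ∧
      (b * y : ZMod a) = r * z ∧ (a * x : ZMod b) = s * z ∧ (a * x : ZMod c) = u * y := by
  have : NeZero a := ⟨ha.ne'⟩
  have : NeZero b := ⟨hb.ne'⟩
  have : NeZero c := ⟨hc.ne'⟩
  set S := Finset.range (Nat.sqrt (b * c) + 1) ×ˢ Finset.range (Nat.sqrt (a * c) + 1) ×ˢ
    Finset.range (Nat.sqrt (a * b) + 1) with hS
  let f : ℕ × ℕ × ℕ → ZMod a × ZMod b × ZMod c := fun v =>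
    (b * v.2.1 - r * v.2.2, a * v.1 - s * v.2.2, a * v.1 - u * v.2.1)
  have hcard : (Finset.univ : Finset (ZMod a × ZMod b × ZMod c)).card < S.card := by
    simp only [hS, Finset.card_product, Finset.card_range, Finset.card_univ, Fintype.card_prod,
      ZMod.card]
    refine lt_of_pow_lt_pow_left₀ 2 (Nat.zero_le _) ?_
    calc (a * (b * c)) ^ 2 = (b * c) * ((a * c) * (a * b)) := by ring
      _ < (Nat.sqrt (b * c) + 1) ^ 2 * ((Nat.sqrt (a * c) + 1) ^ 2 * (Nat.sqrt (a * b) + 1) ^ 2) :=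
        Nat.mul_lt_mul'' (Nat.lt_succ_sqrt' _)
          (Nat.mul_lt_mul'' (Nat.lt_succ_sqrt' _) (Nat.lt_succ_sqrt' _))
      _ = _ := by ring
  obtain ⟨⟨x, y, z⟩, hv, ⟨x', y', z'⟩, hv', hne, hf⟩ :=
    Finset.exists_ne_map_eq_of_card_lt_of_maps_to hcard (f := f) (fun _ _ => Finset.mem_univ _)
  simp only [hS, Finset.mem_product, Finset.mem_range, Nat.lt_succ_iff] at hv hv'
  simp only [f, Prod.mk.injEq] at hf
  have bound : ∀ {m i j : ℕ}, i ≤ Nat.sqrt m → j ≤ Nat.sqrt m → ((i : ℤ) - j) ^ 2 ≤ m := by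
    intro m i j hi hj
    have h1 : ((i : ℤ) - j) ^ 2 ≤ (Nat.sqrt m : ℤ) ^ 2 := by
      refine sq_le_sq' ?_ ?_ <;> omega
    exact h1.trans (by exact_mod_cast Nat.sqrt_le' m)
  refine ⟨x - x', y - y', z - z', ?_, ?_, ?_, ?_, ?_, ?_, ?_⟩
  · intro h
    simp only [Prod.mk.injEq] at h
    apply hne
    simp only [Prod.mk.injEq]
    omega
  · exact_mod_cast bound hv.1 hv'.1
  · exact_mod_cast bound hv.2.1 hv'.2.1
  · exact_mod_cast bound hv.2.2 hv'.2.2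
  · push_cast; linear_combination hf.1
  · push_cast; linear_combination hf.2.1
  · push_cast; linear_combination hf.2.2

/-- A form of Legendre's theorem on the solubility of `a x² + b y² = c z²`. -/
theorem exists_ternary_zero {a b c : ℕ} (ha : 0 < a) (hb : 0 < b) (hc : 0 < c)
    (hab : a.Coprime b) (hac : a.Coprime c) (hbc : b.Coprime c)
    (h₁ : IsSquare ((b * c : ℕ) : ZMod a)) (h₂ : IsSquare ((a * c : ℕ) : ZMod b))
    (h₃ : IsSquare (-(a * b : ℕ) : ZMod c))
    (n₁ : ¬ IsSquare (a * b)) (n₂ : ¬ IsSquare (b * c)) :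
    ∃ x y z : ℤ, (x, y, z) ≠ (0, 0, 0) ∧ a * x ^ 2 + b * y ^ 2 = c * z ^ 2 := by
  obtain ⟨r, hr⟩ := h₁
  obtain ⟨s, hs⟩ := h₂
  obtain ⟨u, hu⟩ := h₃
  push_cast at hr hs hu
  obtain ⟨x, y, z, hne, hx, hy, hz, e₁, e₂, e₃⟩ := exists_small_sub_of_zmod ha hb hc r s u
  have not_sq : ∀ {m : ℕ} {w : ℤ}, ¬ IsSquare m → w ^ 2 ≠ m := by
    intro m w hm hw
    exact hm ⟨w.natAbs, by zify; rw [← sq, sq_abs, hw]⟩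
  have hx' : x ^ 2 < b * c := lt_of_le_of_ne hx (by exact_mod_cast not_sq n₂)
  have hz' : z ^ 2 < a * b := lt_of_le_of_ne hz (by exact_mod_cast not_sq n₁)
  set Q : ℤ := a * x ^ 2 + b * y ^ 2 - c * z ^ 2 with hQ
  have cancel : ∀ {m k : ℕ} {w : ℤ}, Nat.Coprime m k → ((k : ZMod m) * w = 0) → (m : ℤ) ∣ w := by
    intro m k w hmk h
    have : (m : ℤ) ∣ k * w := by
      rw [← ZMod.intCast_zmod_eq_zero_iff_dvd]; push_cast; exact h
    exact (Nat.isCoprime_iff_coprime.2 hmk).dvd_of_dvd_mul_left this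
  have da : (a : ℤ) ∣ Q := by
    refine cancel hab ?_
    rw [hQ]; push_cast
    linear_combination (b * y + r * z : ZMod a) * e₁ - (z : ZMod a) ^ 2 * hr +
      (b * x ^ 2 : ZMod a) * ZMod.natCast_self a
  have db : (b : ℤ) ∣ Q := by
    refine cancel hab.symm ?_
    rw [hQ]; push_cast
    linear_combination (a * x + s * z : ZMod b) * e₂ - (z : ZMod b) ^ 2 * hs +
      (a * y ^ 2 : ZMod b) * ZMod.natCast_self b
  have dc : (c : ℤ) ∣ Q := by
    refine cancel hac.symm ?_
    rw [hQ]; push_cast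
    linear_combination (a * x + u * y : ZMod c) * e₃ - (y : ZMod c) ^ 2 * hu -
      (a * z ^ 2 : ZMod c) * ZMod.natCast_self c
  -- The box bounds give `-abc < Q < 2abc`, strictly because `ab` and `bc` are not squares; so `Q`
  -- is `0` or `abc`.
  obtain ⟨k, hk⟩ : (a * b * c : ℤ) ∣ Q := by
    refine IsCoprime.mul_dvd ?_ (IsCoprime.mul_dvd ?_ da db) dc
    · exact IsCoprime.mul_left (Nat.isCoprime_iff_coprime.2 hac) (Nat.isCoprime_iff_coprime.2 hbc)
    · exact Nat.isCoprime_iff_coprime.2 hab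
  have ha' : (0 : ℤ) < a := by exact_mod_cast ha
  have hb' : (0 : ℤ) < b := by exact_mod_cast hb
  have hc' : (0 : ℤ) < c := by exact_mod_cast hc
  have hpos : (0 : ℤ) < a * b * c := by positivity
  have hupper : Q < a * b * c * 2 := by
    have h1 := mul_lt_mul_of_pos_left hx' ha'
    have h2 := mul_le_mul_of_nonneg_left hy hb'.le
    have h3 : 0 ≤ (c : ℤ) * z ^ 2 := by positivity
    linarith
  have hlower : a * b * c * (-1) < Q := by
    have h1 := mul_lt_mul_of_pos_left hz' hc'
    have h2 : 0 ≤ (a : ℤ) * x ^ 2 := by positivity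
    have h3 : 0 ≤ (b : ℤ) * y ^ 2 := by positivity
    linarith
  rw [hk] at hupper hlower
  have hk₁ := lt_of_mul_lt_mul_left hupper hpos.le
  have hk₂ := lt_of_mul_lt_mul_left hlower hpos.le
  obtain rfl | rfl : k = 0 ∨ k = 1 := by omega
  · exact ⟨x, y, z, hne, by linarith⟩
  -- Here `a x² + b y² = c (z² + ab)`. Multiply by `z² + ab` and use `(a x² + b y²)(z² + ab) = a (xz
  -- - by)² + b (ax + yz)²`.
  · refine ⟨x * z - b * y, a * x + y * z, z ^ 2 + a * b, ?_, ?_⟩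
    · intro h
      simp only [Prod.mk.injEq] at h
      have : 0 < z ^ 2 + (a : ℤ) * b := by positivity
      exact this.ne' h.2.2
    · rw [hQ] at hk
      linear_combination (z ^ 2 + (a : ℤ) * b) * hk

/-! ### The auxiliary prime -/

/-- The factor 2 is harmless because `χ₈` is even. For the odd part `m`, the sign `(-1 | m)` from `t
≡ -p` cancels the reciprocity sign of `m` and `p ≡ 3 [MOD 4]`. -/
theorem jacobiSym_eq_of_dvd_add {n p t : ℕ} (hn : n ≠ 0) (hp : p % 4 = 3) (h : 8 * n ∣ p + t) :
    J(n | t) = J(n | p) := by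
  obtain ⟨k, m, hm, rfl⟩ := Nat.exists_eq_two_pow_mul_odd hn
  have h8 : 8 ∣ p + t := (Dvd.intro _ rfl).trans h
  have hmd : m ∣ p + t := (Dvd.intro_left _ (mul_assoc 8 (2 ^ k) m)).trans h
  have ht4 : t % 4 = 1 := by omega
  have hpo : Odd p := Nat.odd_iff.2 (by omega)
  have hto : Odd t := Nat.odd_iff.2 (by omega)
  have h2 : J(2 | t) = J(2 | p) := by
    rw [jacobiSym.at_two hto, jacobiSym.at_two hpo]
    have hcast : (t : ZMod 8) = -p := by
      have := (ZMod.natCast_eq_zero_iff (p + t) 8).2 h8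
      push_cast at this
      linear_combination this
    have heven : ∀ x : ZMod 8, ZMod.χ₈ (-x) = ZMod.χ₈ x := by decide
    rw [hcast, heven]
  have hm' : J(m | t) = J(m | p) := by
    have hneg : J(t | m) = J(-p | m) := by
      refine jacobiSym.mod_left' (Int.emod_eq_emod_iff_emod_sub_eq_zero.2
        (Int.emod_eq_zero_of_dvd ?_))
      rw [sub_neg_eq_add, add_comm]
      exact_mod_cast hmd
    rw [jacobiSym.quadratic_reciprocity_one_mod_four' hm ht4, hneg, jacobiSym.neg _ hm]
    rcases Nat.odd_mod_four_iff.mp (Nat.odd_iff.1 hm) with h1 | h3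
    · rw [ZMod.χ₄_nat_one_mod_four h1, one_mul,
        jacobiSym.quadratic_reciprocity_one_mod_four h1 hpo]
    · rw [ZMod.χ₄_nat_three_mod_four h3, neg_one_mul,
        jacobiSym.quadratic_reciprocity_three_mod_four h3 hp]
  push_cast
  rw [jacobiSym.mul_left, jacobiSym.mul_left, jacobiSym.pow_left, jacobiSym.pow_left, h2, hm']

theorem exists_prime_dvd_add {p n e : ℕ} (hp : p.Prime) (hp4 : p % 4 = 3) (hn : 0 < n)
    (hpn : ¬ p ∣ n) (he : ¬ p ∣ e) :
    ∃ t : ℕ, t.Prime ∧ p * n < t ∧ t % 4 = 1 ∧ 8 * n ∣ p + t ∧ t ≡ e [MOD p] := by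
  have hp8 : p.Coprime (8 * n) := by
    refine Nat.Coprime.mul_right ?_ ((Nat.Prime.coprime_iff_not_dvd hp).2 hpn)
    rw [show 8 = 2 ^ 3 by norm_num]
    exact Nat.Coprime.pow_right 3 (Nat.odd_iff.2 (by omega)).coprime_two_right
  -- `(8n - 1) p` stands for `-p` modulo `8n`.
  obtain ⟨a, ha₁, ha₂⟩ := Nat.chineseRemainder hp8 e ((8 * n - 1) * p)
  have hcop : a.Coprime (p * (8 * n)) := by
    refine Nat.Coprime.mul_right ?_ ?_
    · rw [Nat.Coprime, ha₁.gcd_eq, Nat.gcd_comm]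
      exact (Nat.Prime.coprime_iff_not_dvd hp).2 he
    · rw [Nat.Coprime, ha₂.gcd_eq]
      refine Nat.Coprime.mul_left ?_ hp8
      refine (Nat.coprime_self_sub_left (by omega)).2 (Nat.coprime_one_left _)
  obtain ⟨t, hgt, htp, hta⟩ := Nat.forall_exists_prime_gt_and_modEq (p * n)
    (mul_ne_zero hp.ne_zero (by omega)) hcop
  have hd : 8 * n ∣ p + t := by
    have h1 : t ≡ (8 * n - 1) * p [MOD 8 * n] := (hta.of_mul_left p).trans ha₂
    have h2 : p + t ≡ p + (8 * n - 1) * p [MOD 8 * n] := h1.add_left p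
    refine (h2.dvd_iff (dvd_refl _)).2 ⟨p, ?_⟩
    obtain ⟨j, hj⟩ : ∃ j, 8 * n = j + 1 := ⟨8 * n - 1, by omega⟩
    rw [hj, Nat.add_sub_cancel]; ring
  have h8 : 8 ∣ p + t := (Dvd.intro _ rfl).trans hd
  exact ⟨t, htp, hgt, by omega, hd, (hta.of_mul_right _).trans ha₁⟩

/-- Since `t ≡ -p`, the class of `-pt` is `p²`. -/
theorem isSquare_neg_mul_of_dvd_add {n p t : ℕ} (h : n ∣ p + t) :
    IsSquare (-(p * t : ℕ) : ZMod n) := by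
  refine ⟨p, ?_⟩
  have := (ZMod.natCast_eq_zero_iff (p + t) n).2 h
  push_cast at this ⊢
  linear_combination -(p : ZMod n) * this

theorem isSquare_zmod_mul {m n : ℕ} (h : m.Coprime n) {d : ℕ} (hm : IsSquare (d : ZMod m))
    (hn : IsSquare (d : ZMod n)) : IsSquare (d : ZMod (m * n)) := by
  obtain ⟨x, hx⟩ := hm
  obtain ⟨y, hy⟩ := hn
  refine ⟨(ZMod.chineseRemainder h).symm (x, y), (ZMod.chineseRemainder h).injective ?_⟩
  rw [map_mul, RingEquiv.apply_symm_apply, map_natCast, Prod.mk_mul_mk, ← hx, ← hy]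
  rfl

/-! ### Necessity: descent at `p` -/

/-- The zeros of `p x₁² + p x₂² + x₃² - D x₄²`, for a non-residue `D` modulo `p`, admit
descent by `p`. -/
theorem dvd_of_zero_of_not_isSquare {p : ℕ} (hp : p.Prime) (hp4 : p % 4 = 3) {D : ℤ}
    (hD : ¬ IsSquare (D : ZMod p)) {x₁ x₂ x₃ x₄ : ℤ}
    (h : (p : ℤ) * x₁ ^ 2 + (p : ℤ) * x₂ ^ 2 + x₃ ^ 2 - D * x₄ ^ 2 = 0) :
    (p : ℤ) ∣ x₁ ∧ (p : ℤ) ∣ x₂ ∧ (p : ℤ) ∣ x₃ ∧ (p : ℤ) ∣ x₄ := by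
  have : Fact p.Prime := ⟨hp⟩
  have hcast := congrArg (Int.cast : ℤ → ZMod p) h
  push_cast at hcast
  rw [ZMod.natCast_self] at hcast
  have h4 : (x₄ : ZMod p) = 0 := by
    by_contra h0
    refine hD ⟨x₃ / x₄, ?_⟩
    field_simp
    linear_combination -hcast
  have h3 : (x₃ : ZMod p) = 0 := by
    rw [h4] at hcast
    refine pow_eq_zero_iff (two_ne_zero) |>.1 ?_
    linear_combination hcast
  rw [ZMod.intCast_zmod_eq_zero_iff_dvd] at h3 h4
  obtain ⟨y₃, rfl⟩ := h3
  obtain ⟨y₄, rfl⟩ := h4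
  have hp0 : (p : ℤ) ≠ 0 := by exact_mod_cast hp.ne_zero
  have h' : x₁ ^ 2 + x₂ ^ 2 + p * y₃ ^ 2 - D * (p * y₄ ^ 2) = 0 := by
    refine (mul_eq_zero.1 ?_).resolve_left hp0
    linear_combination h
  have hcast' := congrArg (Int.cast : ℤ → ZMod p) h'
  push_cast at hcast'
  rw [ZMod.natCast_self] at hcast'
  have h2 : (x₂ : ZMod p) = 0 := by
    by_contra h0
    exact ZMod.mod_four_ne_three_of_sq_eq_neg_sq' h0
      (show (x₁ : ZMod p) ^ 2 = -(x₂ : ZMod p) ^ 2 by linear_combination hcast') hp4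
  have h1 : (x₁ : ZMod p) = 0 := by
    rw [h2] at hcast'
    refine pow_eq_zero_iff (two_ne_zero) |>.1 ?_
    linear_combination hcast'
  rw [ZMod.intCast_zmod_eq_zero_iff_dvd] at h1 h2
  exact ⟨h1, h2, dvd_mul_right _ _, dvd_mul_right _ _⟩

theorem pow_dvd_of_zero_of_not_isSquare {p : ℕ} (hp : p.Prime) (hp4 : p % 4 = 3) {D : ℤ}
    (hD : ¬ IsSquare (D : ZMod p)) (n : ℕ) : ∀ {x₁ x₂ x₃ x₄ : ℤ},
    (p : ℤ) * x₁ ^ 2 + (p : ℤ) * x₂ ^ 2 + x₃ ^ 2 - D * x₄ ^ 2 = 0 →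
    (p : ℤ) ^ n ∣ x₁ ∧ (p : ℤ) ^ n ∣ x₂ ∧ (p : ℤ) ^ n ∣ x₃ ∧ (p : ℤ) ^ n ∣ x₄ := by
  induction n with
  | zero => simp
  | succ n ih =>
    intro x₁ x₂ x₃ x₄ h
    obtain ⟨⟨y₁, rfl⟩, ⟨y₂, rfl⟩, ⟨y₃, rfl⟩, ⟨y₄, rfl⟩⟩ := dvd_of_zero_of_not_isSquare hp hp4 hD h
    have hp0 : (p : ℤ) ^ 2 ≠ 0 := pow_ne_zero 2 (by exact_mod_cast hp.ne_zero)
    have h' : (p : ℤ) * y₁ ^ 2 + (p : ℤ) * y₂ ^ 2 + y₃ ^ 2 - D * y₄ ^ 2 = 0 := by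
      refine (mul_eq_zero.1 ?_).resolve_left hp0
      linear_combination h
    obtain ⟨h1, h2, h3, h4⟩ := ih h'
    rw [pow_succ']
    exact ⟨mul_dvd_mul_left _ h1, mul_dvd_mul_left _ h2, mul_dvd_mul_left _ h3,
      mul_dvd_mul_left _ h4⟩

theorem isSquare_of_zero {p : ℕ} (hp : p.Prime) (hp4 : p % 4 = 3) {D x₁ x₂ x₃ x₄ : ℤ}
    (hne : (x₁, x₂, x₃, x₄) ≠ (0, 0, 0, 0))
    (h : (p : ℤ) * x₁ ^ 2 + (p : ℤ) * x₂ ^ 2 + x₃ ^ 2 - D * x₄ ^ 2 = 0) :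
    IsSquare (D : ZMod p) := by
  by_contra hD
  have zero : ∀ {x : ℤ}, (∀ n : ℕ, (p : ℤ) ^ n ∣ x) → x = 0 := by
    intro x hx
    refine Int.eq_zero_of_dvd_of_natAbs_lt_natAbs (hx x.natAbs) ?_
    rw [Int.natAbs_pow, Int.natAbs_natCast]
    exact Nat.lt_pow_self hp.one_lt
  have key := fun n => pow_dvd_of_zero_of_not_isSquare hp hp4 hD n h
  refine hne ?_
  rw [zero fun n => (key n).1, zero fun n => (key n).2.1, zero fun n => (key n).2.2.1,
    zero fun n => (key n).2.2.2]

/-! ### Sufficiency -/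

theorem exists_zero_of_not_dvd {p d : ℕ} (hp : p.Prime) (hp4 : p % 4 = 3) (hd : 0 < d)
    (hpd : ¬ p ∣ d) (hsq : IsSquare (d : ZMod p)) :
    ∃ x₁ x₂ x₃ x₄ : ℤ, (x₁, x₂, x₃, x₄) ≠ (0, 0, 0, 0) ∧
      (p : ℤ) * x₁ ^ 2 + (p : ℤ) * x₂ ^ 2 + x₃ ^ 2 - d * x₄ ^ 2 = 0 := by
  have : Fact p.Prime := ⟨hp⟩
  -- The class of `t` mod `p` is immaterial here; 1 is just a unit.
  obtain ⟨t, ht, hgt, ht4, hdvd, -⟩ := exists_prime_dvd_add hp hp4 hd hpd hp.not_dvd_one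
  have : Fact t.Prime := ⟨ht⟩
  have hpt : p < t := (Nat.le_mul_of_pos_right p hd).trans_lt hgt
  have hdt : d < t := (Nat.le_mul_of_pos_left d hp.pos).trans_lt hgt
  have cpt : p.Coprime t := (Nat.coprime_primes hp ht).2 hpt.ne
  have cpd : p.Coprime d := (Nat.Prime.coprime_iff_not_dvd hp).2 hpd
  have ctd : t.Coprime d := (Nat.Prime.coprime_iff_not_dvd ht).2 (Nat.not_dvd_of_pos_of_lt hd hdt)
  have hpnt : ¬ p ∣ t := (Nat.Prime.coprime_iff_not_dvd hp).1 cpt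
  have hsqt : IsSquare (d : ZMod t) := by
    have hJ : J(d | t) = 1 := by
      rw [jacobiSym_eq_of_dvd_add hd.ne' hp4 hdvd, ← jacobiSym.legendreSym.to_jacobiSym,
        legendreSym.eq_one_iff']
      · exact hsq
      · rwa [Ne, ZMod.natCast_eq_zero_iff]
    exact_mod_cast ZMod.isSquare_of_jacobiSym_eq_one hJ
  -- Solves `x² + p t y² = d z²`.
  obtain ⟨x, y, z, hne, h⟩ := exists_ternary_zero (a := 1) (b := p * t) (c := d) one_pos
    (Nat.mul_pos hp.pos ht.pos) hd (Nat.coprime_one_left _) (Nat.coprime_one_left _)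
    (cpd.mul_left ctd) ⟨0, Subsingleton.elim _ _⟩
    (by rw [one_mul]; exact isSquare_zmod_mul cpt hsq hsqt)
    (by rw [one_mul]; exact isSquare_neg_mul_of_dvd_add ((Dvd.intro_left _ rfl).trans hdvd))
    (by rw [one_mul]; exact not_isSquare_prime_mul hp hpnt)
    (by rw [mul_assoc]; exact not_isSquare_prime_mul hp (hp.not_dvd_mul hpnt hpd))
  obtain ⟨u, v, huv⟩ := Nat.Prime.sq_add_sq (p := t) (by omega)
  have huv' : (u : ℤ) ^ 2 + v ^ 2 = t := by exact_mod_cast huv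
  refine ⟨u * y, v * y, x, z, ?_, ?_⟩
  · intro h0
    simp only [Prod.mk.injEq] at h0
    obtain ⟨h1, h2, rfl, rfl⟩ := h0
    refine hne ?_
    have ht0 : (t : ℤ) ≠ 0 := by exact_mod_cast ht.ne_zero
    have : (t : ℤ) * y = 0 := by linear_combination (u : ℤ) * h1 + v * h2 - y * huv'
    rw [(mul_eq_zero.1 this).resolve_left ht0]
  · push_cast at h
    linear_combination h + (p : ℤ) * y ^ 2 * huv'

theorem exists_zero_of_dvd {p d : ℕ} (hp : p.Prime) (hp4 : p % 4 = 3) (hd : 0 < d)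
    (hpd : ¬ p ∣ d) :
    ∃ x₁ x₂ x₃ x₄ : ℤ, (x₁, x₂, x₃, x₄) ≠ (0, 0, 0, 0) ∧
      (p : ℤ) * x₁ ^ 2 + (p : ℤ) * x₂ ^ 2 + x₃ ^ 2 - (p * d : ℕ) * x₄ ^ 2 = 0 := by
  have : Fact p.Prime := ⟨hp⟩
  -- Taking `t ≡ d` mod `p` makes `td` a square mod `p` and gives `(pd | t) = (t | p)(d | p) = (d |
  -- p)² = 1`.
  obtain ⟨t, ht, hgt, ht4, hdvd, htd⟩ := exists_prime_dvd_add hp hp4 hd hpd hpd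
  have : Fact t.Prime := ⟨ht⟩
  have hpt : p < t := (Nat.le_mul_of_pos_right p hd).trans_lt hgt
  have hdt : d < t := (Nat.le_mul_of_pos_left d hp.pos).trans_lt hgt
  have cpt : p.Coprime t := (Nat.coprime_primes hp ht).2 hpt.ne
  have cpd : p.Coprime d := (Nat.Prime.coprime_iff_not_dvd hp).2 hpd
  have ctd : t.Coprime d := (Nat.Prime.coprime_iff_not_dvd ht).2 (Nat.not_dvd_of_pos_of_lt hd hdt)
  have hpnt : ¬ p ∣ t := (Nat.Prime.coprime_iff_not_dvd hp).1 cpt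
  have hsqt : IsSquare ((p * d : ℕ) : ZMod t) := by
    have hJ : J((p * d : ℕ) | t) = 1 := by
      have hpo : Odd p := Nat.odd_iff.2 (by omega)
      have hmod : J(t | p) = J(d | p) := jacobiSym.mod_left' (by exact_mod_cast htd)
      rw [Nat.cast_mul, jacobiSym.mul_left, jacobiSym_eq_of_dvd_add hd.ne' hp4 hdvd,
        ← jacobiSym.quadratic_reciprocity_one_mod_four ht4 hpo, hmod, ← sq]
      exact jacobiSym.sq_one (by simpa using cpd.symm)
    exact_mod_cast ZMod.isSquare_of_jacobiSym_eq_one hJ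
  have hsqp : IsSquare ((t * d : ℕ) : ZMod p) := by
    refine ⟨d, ?_⟩
    rw [Nat.cast_mul, (ZMod.natCast_eq_natCast_iff _ _ _).2 htd]
  obtain ⟨x, y, z, hne, h⟩ := exists_ternary_zero ht.pos hp.pos hd cpt.symm ctd cpd hsqt hsqp
    (by rw [mul_comm t]; exact isSquare_neg_mul_of_dvd_add ((Dvd.intro_left _ rfl).trans hdvd))
    (by rw [mul_comm]; exact not_isSquare_prime_mul hp hpnt)
    (not_isSquare_prime_mul hp hpd)
  obtain ⟨u, v, huv⟩ := Nat.Prime.sq_add_sq (p := t) (by omega)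
  have huv' : (u : ℤ) ^ 2 + v ^ 2 = t := by exact_mod_cast huv
  -- Multiply `t x² + p y² = d z²` by `p`.
  refine ⟨u * x, v * x, p * y, z, ?_, ?_⟩
  · intro h0
    simp only [Prod.mk.injEq] at h0
    obtain ⟨h1, h2, h3, rfl⟩ := h0
    refine hne ?_
    have ht0 : (t : ℤ) ≠ 0 := by exact_mod_cast ht.ne_zero
    have hp0 : (p : ℤ) ≠ 0 := by exact_mod_cast hp.ne_zero
    have : (t : ℤ) * x = 0 := by linear_combination (u : ℤ) * h1 + v * h2 - x * huv'
    rw [(mul_eq_zero.1 this).resolve_left ht0, (mul_eq_zero.1 h3).resolve_left hp0]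
  · push_cast
    linear_combination (p : ℤ) * h + (p : ℤ) * x ^ 2 * huv'

theorem mainTheorem5 (p : ℕ) (hp : p.Prime) (hp4 : p % 4 = 3)
    (D : ℤ) (hD : 0 < D) (hpD : ¬ (p : ℤ) ^ 2 ∣ D) :
    (∃ x₁ x₂ x₃ x₄ : ℤ, (x₁, x₂, x₃, x₄) ≠ (0, 0, 0, 0) ∧
        (p : ℤ) * x₁ ^ 2 + (p : ℤ) * x₂ ^ 2 + x₃ ^ 2 - D * x₄ ^ 2 = 0) ↔
      IsSquare (D : ZMod p) := by
  constructor
  · rintro ⟨x₁, x₂, x₃, x₄, hne, h⟩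
    exact isSquare_of_zero hp hp4 hne h
  · intro hsq
    lift D to ℕ using hD.le
    by_cases hdvd : p ∣ D
    · obtain ⟨d, rfl⟩ := hdvd
      refine exists_zero_of_dvd hp hp4 (Nat.pos_of_ne_zero ?_) ?_
      · rintro rfl
        simp at hD
      · rintro ⟨e, rfl⟩
        exact hpD ⟨e, by push_cast; ring⟩
    · exact exists_zero_of_not_dvd hp hp4 (by exact_mod_cast hD) hdvd (by simpa using hsq)
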